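/- Let $n\ge 0$ be an integer and let $q\ge 0$ be real. A configuration is a word $X\in\{\circ,\bullet\}^n$; the letters $\bullet$ are called particles. The ASEP on $n$ sites with parameters $\alpha,\beta,q$ is the chain on the set of configurations with transition matrix $P$ given as follows. For configurations of the form $X=A\bullet\circ B$, $Y=A\circ\bullet B$ put $P_{X,Y}=\frac1{n+1}$ and $P_{Y,X}=\frac q{n+1}$; for $X=\circ B$, $Y=\bullet B$ put $P_{X,Y}=\frac{\alpha}{n+1}$; for $X=B\bullet$, $Y=B\circ$ put $P_{X,Y}=\frac{\beta}{n+1}$; otherwise $P_{X,Y}=0$ for $Y\ne X$; and $P_{X,X}=1-\sum_{Y\neq X}P_{X,Y}$. A stationary distribution is a probability vector $\pi$ with $\pi P=\pi$. Put $[m]_q=1+q+\dots+q^{m-1}$. A bicolored Motzkin path of length $n$ is a sequence $p=(p_1,\dots,p_n)$ of steps in $\{N,S,E,\bar E\}$, where $N$ raises the height by $1$, $S$ lowers it by $1$, and $E,\bar E$ keep it, which starts and ends at height $0$ and never has negative height. Its weight $w(p)$ is the product of the weights of its steps, where a step starting at height $h$ has weight $$[h+1]_q \ (N),\qquad [h]_q+\frac{q^h}{\alpha}\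 (\bar E),\qquad [h]_q+\frac{q^h}{\beta}\ (E),\qquad [h]_q+\frac{q^h}{\alpha\beta}-q^{h-1}\Bigl(\frac1\alpha-1\Bigr)\Bigl(\frac1\beta-1\Bigr)\ (S).$$ Let $\theta(p)$ be the configuration obtained from $p$ by replacing each $E$ and $N$ by $\bullet$ and each $\bar E$ and $S$ by $\circ$. Put $W(X)=\sum_{p:\,\theta(p)=X}w(p)$ and $Z_n=\sum_X W(X)$. (For $\alpha=\beta=1$ every step starting at height $h$ has weight $[h+1]_q$.) For integers $1\le k\le n$ let $$\hat E_{k,n}(q)=q^{k-k^2}\sum_{i=0}^{k-1}(-1)^i\,[k-i]_q^{\,n}\,q^{k(i-1)}\left(\binom ni q^{k-i}+\binom n{i-1}\right),\qquad \binom n{-1}=0,$$ a Laurent polynomial in the indeterminate $q$. Theorem. Let $\alpha=\beta=1$. Then the ASEP on $n$ sites has a unique stationary distribution $\pi$, one has $Z_n>0$, and for every $0\le k\le n$ the Laurent polynomial $\hat E_{k+1,n+1}$ is a polynomial in $q$ (so that it has a value also at $q=0$), and the stationary probability that the configuration has exactly $k$ particles is $$\sum_{X\text{ with }k\text{ particles}}\pi(X)=\frac{\hat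 E_{k+1,n+1}(q)}{Z_n}.$$ -/

import Mathlib

open scoped LaurentPolynomial Matrix

noncomputable section

/-! ## The `q`-Eulerian polynomials -/

/-- The `q`-integer `[m]_q = 1 + q + ⋯ + q ^ (m - 1)` in a commutative ring. -/
def qInt {R : Type*} [CommRing R] (m : ℕ) (q : R) : R :=
  ∑ j ∈ Finset.range m, q ^ j

/-- The binomial coefficient `n choose (i - 1)`, which is zero for `i = 0`. -/
def choosePred (n i : ℕ) : ℕ :=
  if i = 0 then 0 else n.choose (i - 1)

/-- The explicit expression
`q^(k-k²) ∑_{i=0}^{k-1} (-1)^i [k-i]_q^n q^(k(i-1)) (C(n,i) q^(k-i) + C(n,i-1))`,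
as a Laurent polynomial in the indeterminate `q = T 1`. All exponents are integers. -/
def qEulerianLaurent (k n : ℕ) : ℤ[T;T⁻¹] :=
  LaurentPolynomial.T ((k : ℤ) - (k : ℤ) ^ 2) *
    ∑ i ∈ Finset.range k,
      (-1) ^ i * qInt (k - i) (LaurentPolynomial.T 1 : ℤ[T;T⁻¹]) ^ n *
        LaurentPolynomial.T ((k : ℤ) * ((i : ℤ) - 1)) *
        ((n.choose i : ℤ[T;T⁻¹]) * LaurentPolynomial.T ((k : ℤ) - (i : ℤ)) +
          (choosePred n i : ℤ[T;T⁻¹]))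

/-- The `q`-Eulerian number `Ê_{k,n}(q)`, as a polynomial in `q`: the Laurent polynomial
`qEulerianLaurent k n`, read as an ordinary polynomial (so that it may be evaluated at `q = 0`).
In general `LaurentPolynomial.trunc` discards negative powers; that there are none here is
part of the main theorem. -/
def qEulerian (k n : ℕ) : Polynomial ℤ :=
  LaurentPolynomial.trunc (qEulerianLaurent k n)

/-! ## The ASEP Markov chain -/

/-- Basic configurations on `n` cells: `true` is a black particle, `false` a white one. -/
abbrev Config (n : ℕ) : Type := Fin n → Bool

/-- The number of (black) particles of a configuration. -/
def numParticles {n : ℕ} (X : Config n) : ℕ :=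
  (Finset.univ.filter fun i => X i = true).card

/-- `X = A•∘B` and `Y = A∘•B`. -/
def HopsRight {n : ℕ} (X Y : Config n) : Prop :=
  ∃ i j : Fin n, j.val = i.val + 1 ∧ X i = true ∧ X j = false ∧ Y i = false ∧ Y j = true ∧
    ∀ l, l ≠ i → l ≠ j → Y l = X l

/-- `X = ∘B` and `Y = •B`. -/
def Enters {n : ℕ} (X Y : Config n) : Prop :=
  ∃ i : Fin n, i.val = 0 ∧ X i = false ∧ Y i = true ∧ ∀ l, l ≠ i → Y l = X l

/-- `X = B•` and `Y = B∘`. -/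
def Exits {n : ℕ} (X Y : Config n) : Prop :=
  ∃ i : Fin n, i.val + 1 = n ∧ X i = true ∧ Y i = false ∧ ∀ l, l ≠ i → Y l = X l

open Classical in
/-- The probability of a jump from `X` to a different configuration `Y`. -/
def jumpProb {n : ℕ} (α β q : ℝ) (X Y : Config n) : ℝ :=
  if HopsRight X Y then 1 / ((n : ℝ) + 1)
  else if HopsRight Y X then q / ((n : ℝ) + 1)
  else if Enters X Y then α / ((n : ℝ) + 1)
  else if Exits X Y then β / ((n : ℝ) + 1)
  else 0

/-- The transition matrix `P` of the ASEP on `n` cells: `asep n α β q X Y` is the probability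
to be in state `Y` at time `t + 1` given state `X` at time `t`. -/
def asep (n : ℕ) (α β q : ℝ) : Matrix (Config n) (Config n) ℝ :=
  fun X Y =>
    if X = Y then 1 - ∑ Y' ∈ Finset.univ.erase X, jumpProb α β q X Y'
    else jumpProb α β q X Y

/-- `π` is a stationary distribution of `P`: a probability vector with `π P = π`. -/
def IsStationaryDist {S : Type*} [Fintype S] (P : Matrix S S ℝ) (π : S → ℝ) : Prop :=
  π ∈ stdSimplex ℝ S ∧ π ᵥ* P = π

/-! ## Weighted bicolored Motzkin paths -/

/-- Steps of a bicolored Motzkin path: up (`N`), down (`S`), and two kinds of horizontal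
steps, `E` and `Ebar`. -/
inductive MStep : Type
  | N | S | E | Ebar
  deriving DecidableEq

instance : Fintype MStep where
  elems := {MStep.N, MStep.S, MStep.E, MStep.Ebar}
  complete := by intro s; cases s <;> simp

/-- The change of height along a step. -/
def MStep.rise : MStep → ℤ
  | .N => 1
  | .S => -1
  | .E => 0
  | .Ebar => 0

/-- Whether the step becomes a black particle (`E` and `N` do, `Ebar` and `S` do not). -/
def MStep.color : MStep → Bool
  | .N => true
  | .S => false
  | .E => true
  | .Ebar => false

/-- The height reached after the first `i` steps of `p`. -/
def pathHeight {n : ℕ} (p : Fin n → MStep) (i : ℕ) : ℤ :=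
  ∑ j ∈ Finset.univ.filter (fun j : Fin n => j.val < i), (p j).rise

/-- `p` is a bicolored Motzkin path: it never goes below height `0` and ends at height `0`. -/
def IsMotzkin {n : ℕ} (p : Fin n → MStep) : Prop :=
  (∀ i : ℕ, i ≤ n → 0 ≤ pathHeight p i) ∧ pathHeight p n = 0

/-- The weight of a step starting at height `h`. (A down step has `h ≥ 1`.) -/
def stepWeight (α β q : ℝ) (h : ℕ) : MStep → ℝ
  | .N => qInt (h + 1) q
  | .Ebar => qInt h q + q ^ h / α
  | .E => qInt h q + q ^ h / β
  | .S => qInt h q + q ^ h / (α * β) - q ^ (h - 1) * (1 / α - 1) * (1 / β - 1)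

/-- The weight of a path: the product of the weights of its steps. -/
def pathWeight {n : ℕ} (α β q : ℝ) (p : Fin n → MStep) : ℝ :=
  ∏ i : Fin n, stepWeight α β q (pathHeight p i.val).toNat (p i)

/-- The configuration `θ(p)` of a path. -/
def theta {n : ℕ} (p : Fin n → MStep) : Config n := fun i => (p i).color

open Classical in
/-- `W(X)`: the total weight of the bicolored Motzkin paths `p` with `θ(p) = X`. -/
def configWeight {n : ℕ} (α β q : ℝ) (X : Config n) : ℝ :=
  ∑ p ∈ Finset.univ.filter (fun p : Fin n → MStep => IsMotzkin p ∧ theta p = X),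
    pathWeight α β q p

/-- `Z_n`: the sum of `W(X)` over all configurations. -/
def partitionFn (n : ℕ) (α β q : ℝ) : ℝ :=
  ∑ X : Config n, configWeight α β q X

end

/-!
At `α = β = 1` the step weights of the Motzkin paths are the entries of two tridiagonal matrices
`D` (particles) and `E` (holes), with row `h` having the entries `[h + 1]_q`, so that `W(X)` is the
`(0, 0)` entry of a product of these matrices (`configWeight_eq_wordVec`). They satisfy
`DE - qED = D + E`, the first row of `E` and the first column of `D` are unit vectors, and the
usual matrix ansatz follows: the net flow into a configuration through each bond is a difference of
weights of words with one letter deleted, the sum over the bonds telescopes, and the ends cancel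
against the flow through the boundaries (`isBalanced_configWeight`). The weights are positive and
the chain is irreducible even for `q = 0`, so the stationary distribution is `W / Z_n` and nothing
else (`IsStationaryDist.eq_configWeight_div`).

It remains to find the coefficient of `y ^ k` in the `(0, 0)` entry of `(yD + E) ^ n`, for an
indeterminate `q`. On generating functions of column vectors, conjugated by the powers of `y`, the
matrix `yD + E` acts as `f ↦ Δ ((1 + x) (1 + y x) f)` with the `q`-derivative `Δ`. With
`Θ = (1 + x) (1 + y x) Δ` the entry sought is therefore the value of `Θ ^ (n + 1) x` at `x = 0`
(`totalVec_zero_eq`). Since `(1 - q) x Δ f = f(x) - f(q x)`, the products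
`g_j = ∏_{i < j} (1 + q ^ i x) / ∏_{1 ≤ i ≤ j} (1 + y q ^ (-i) x)` are eigenfunctions of `Θ` with
eigenvalues `[j]_q (1 - y q ^ (-j))` (`thetaOp_eigenFun`). The function `1 + x`, which has the same
image under `Θ` as `x`, expands in them by a telescoping sum whose remainder is divisible by any
given power of `y` (`one_add_X_eq_sum`). This yields
`∑_{j ≥ 1} y ^ (j - 1) q ^ (j - j ^ 2) (1 - y q ^ (-2 j)) ([j]_q (1 - y q ^ (-j))) ^ (n + 1)`
as a series in `y`, and its coefficients are the `q`-Eulerian numbers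
(`sum_wordVec_T_eq_qEulerianLaurent`). As the matrices have entries in `ℤ[q]`, the coefficients are
polynomials in `q`.
-/

noncomputable section

/-! ### The matrix ansatz -/

section Ansatz

variable {R : Type*} [CommRing R]

theorem qInt_zero (q : R) : qInt 0 q = 0 := by simp [qInt]

theorem qInt_one (q : R) : qInt 1 q = 1 := by simp [qInt]

theorem qInt_succ (m : ℕ) (q : R) : qInt (m + 1) q = qInt m q + q ^ m := by
  simp [qInt, Finset.sum_range_succ]

theorem qInt_succ' (m : ℕ) (q : R) : qInt (m + 1) q = 1 + q * qInt m q := by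
  simp [qInt, Finset.sum_range_succ', Finset.mul_sum, pow_succ']
  ring

theorem one_sub_mul_qInt (m : ℕ) (q : R) : (1 - q) * qInt m q = 1 - q ^ m := by
  induction m with
  | zero => simp [qInt_zero]
  | succ m ih => rw [qInt_succ, mul_add, ih]; ring

theorem map_qInt {S : Type*} [CommRing S] (f : R →+* S) (m : ℕ) (q : R) :
    f (qInt m q) = qInt m (f q) := by
  simp [qInt]

/-- The column vector `v` shifted down by one place, with a zero on top. -/
def shiftDown (v : ℕ → R) : ℕ → R
  | 0 => 0
  | h + 1 => v h

/-- The action on column vectors of the tridiagonal matrix of a letter at `α = β = 1`: the matrix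
`D` of a particle (steps `E` and `N`) for `true`, the matrix `E` of a hole (steps `Ebar` and `S`)
for `false`. Its row `h` lists the weights of the steps starting at height `h`. -/
def letterOp (q : R) (b : Bool) (v : ℕ → R) : ℕ → R :=
  fun h => qInt (h + 1) q * (v h + if b then v (h + 1) else shiftDown v h)

/-- The column vector obtained by applying the matrices of the letters of a word to the unit
vector at height `0`. Its entry at `h` is the total weight of the paths from height `h` to height
`0` which are coloured by the word. -/
def wordVec (q : R) : List Bool → ℕ → R
  | [] => fun h => if h = 0 then 1 else 0
  | b :: w => letterOp q b (wordVec q w)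

theorem letterOp_add (q : R) (b : Bool) (u v : ℕ → R) :
    letterOp q b (u + v) = letterOp q b u + letterOp q b v := by
  funext h
  rcases h with _ | h <;> cases b <;> simp [letterOp, shiftDown] <;> ring

theorem letterOp_smul (q c : R) (b : Bool) (v : ℕ → R) :
    letterOp q b (c • v) = c • letterOp q b v := by
  funext h
  rcases h with _ | h <;> cases b <;> simp [letterOp, shiftDown] <;> ring

/-- The relation `DE - qED = D + E`. -/
theorem letterOp_true_false (q : R) (v : ℕ → R) :
    letterOp q true (letterOp q false v) =
      q • letterOp q false (letterOp q true v) + (letterOp q true v + letterOp q false v) := by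
  funext h
  rcases h with _ | h
  · simp [letterOp, shiftDown, qInt_succ', qInt_zero]
    ring
  · simp only [letterOp, shiftDown, Pi.add_apply, Pi.smul_apply, smul_eq_mul, if_true,
      Bool.false_eq_true, if_false]
    rw [qInt_succ' (h + 1 + 1), qInt_succ' (h + 1)]
    ring

theorem wordVec_append_true_false (q : R) (A B : List Bool) :
    wordVec q (A ++ true :: false :: B) = q • wordVec q (A ++ false :: true :: B) +
      (wordVec q (A ++ true :: B) + wordVec q (A ++ false :: B)) := by
  induction A with
  | nil => exact letterOp_true_false q _
  | cons a A ih => simp only [List.cons_append, wordVec, ih, letterOp_add, letterOp_smul]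

theorem wordVec_false_cons_zero (q : R) (w : List Bool) :
    wordVec q (false :: w) 0 = wordVec q w 0 := by
  simp [wordVec, letterOp, shiftDown, qInt_one]

theorem wordVec_append_singleton_true (q : R) (w : List Bool) :
    wordVec q (w ++ [true]) = wordVec q w := by
  induction w with
  | nil =>
    funext h
    rcases h with _ | h <;> simp [wordVec, letterOp, qInt_one]
  | cons a w ih => simp only [List.cons_append, wordVec, ih]

theorem map_wordVec {S : Type*} [CommRing S] (f : R →+* S) (q : R) (w : List Bool) (h : ℕ) :
    f (wordVec q w h) = wordVec (f q) w h := by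
  induction w generalizing h with
  | nil => simp [wordVec, apply_ite f]
  | cons a w ih =>
    rcases h with _ | h <;> cases a <;> simp [wordVec, letterOp, shiftDown, ih, map_qInt]

end Ansatz

theorem qInt_succ_pos {q : ℝ} (hq : 0 ≤ q) (m : ℕ) : 0 < qInt (m + 1) q := by
  rw [qInt_succ']
  have : 0 ≤ qInt m q := Finset.sum_nonneg fun _ _ => by positivity
  positivity

theorem wordVec_nonneg {q : ℝ} (hq : 0 ≤ q) (w : List Bool) (h : ℕ) : 0 ≤ wordVec q w h := by
  induction w generalizing h with
  | nil => simp only [wordVec]; split_ifs <;> norm_num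
  | cons a w ih =>
    have := (qInt_succ_pos hq h).le
    refine mul_nonneg this (add_nonneg (ih h) ?_)
    rcases h with _ | h <;> cases a <;> simp [shiftDown, ih]

theorem wordVec_zero_pos {q : ℝ} (hq : 0 ≤ q) (w : List Bool) : 0 < wordVec q w 0 := by
  induction w with
  | nil => simp [wordVec]
  | cons a w ih =>
    refine mul_pos (qInt_succ_pos hq 0) (add_pos_of_pos_of_nonneg ih ?_)
    cases a
    · simp [shiftDown]
    · simpa using wordVec_nonneg hq w 1

/-! ### Path weights as matrix products -/

theorem pathHeight_zero {n : ℕ} (p : Fin n → MStep) : pathHeight p 0 = 0 := by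
  simp [pathHeight]

theorem pathHeight_cons_succ {n : ℕ} (s : MStep) (p : Fin n → MStep) (i : ℕ) :
    pathHeight (Fin.cons s p : Fin (n + 1) → MStep) (i + 1) = s.rise + pathHeight p i := by
  simp only [pathHeight, Finset.sum_filter, Fin.sum_univ_succ]
  simp

open Classical in
/-- The total weight, at `α = β = 1`, of the paths from height `h` to height `0` which are coloured
by `X` and never go below height `0`. -/
def weightFrom (q : ℝ) (h : ℤ) {n : ℕ} (X : Config n) : ℝ :=
  ∑ p : Fin n → MStep,
    if ((∀ i ≤ n, 0 ≤ h + pathHeight p i) ∧ h + pathHeight p n = 0) ∧ theta p = X then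
      ∏ i : Fin n, stepWeight 1 1 q (h + pathHeight p i.val).toNat (p i) else 0

theorem configWeight_eq_weightFrom (q : ℝ) {n : ℕ} (X : Config n) :
    configWeight 1 1 q X = weightFrom q 0 X := by
  rw [configWeight, weightFrom, Finset.sum_filter]
  simp only [IsMotzkin, pathWeight, zero_add]
  refine Finset.sum_congr rfl fun p _ => ?_
  congr

theorem weightFrom_of_neg (q : ℝ) {h : ℤ} (hh : h < 0) {n : ℕ} (X : Config n) :
    weightFrom q h X = 0 := by
  refine Finset.sum_eq_zero fun p _ => if_neg ?_
  rintro ⟨⟨h0, -⟩, -⟩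
  have := h0 0 (Nat.zero_le _)
  rw [pathHeight_zero] at this
  omega

theorem theta_cons_eq_cons {n : ℕ} (s : MStep) (p : Fin n → MStep) (b : Bool) (X : Config n) :
    theta (Fin.cons s p : Fin (n + 1) → MStep) = (Fin.cons b X : Fin (n + 1) → Bool) ↔
      s.color = b ∧ theta p = X := by
  constructor
  · intro h
    refine ⟨by simpa [theta] using congrFun h 0, funext fun i => ?_⟩
    simpa [theta] using congrFun h i.succ
  · rintro ⟨rfl, rfl⟩
    funext i
    refine Fin.cases ?_ (fun i => ?_) i <;> simp [theta]

theorem weightFrom_cons (q : ℝ) {h : ℤ} (hh : 0 ≤ h) {n : ℕ} (b : Bool) (X : Config n) :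
    weightFrom q h (Fin.cons b X : Fin (n + 1) → Bool) =
      ∑ s : MStep, if s.color = b then
        stepWeight 1 1 q h.toNat s * weightFrom q (h + s.rise) X else 0 := by
  classical
  unfold weightFrom
  rw [← (Fin.consEquiv fun _ => MStep).sum_comp, Fintype.sum_prod_type]
  refine Finset.sum_congr rfl fun s _ => ?_
  have hite : ∀ (c : Prop) [Decidable c] (f : (Fin n → MStep) → ℝ),
      (if c then ∑ p, f p else 0) = ∑ p, if c then f p else 0 := by
    intro c _ f
    split_ifs <;> simp
  rw [Finset.mul_sum, hite]
  refine Finset.sum_congr rfl fun p _ => ?_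
  have hcons : (Fin.consEquiv fun _ => MStep) (s, p) = (Fin.cons s p : Fin (n + 1) → MStep) := rfl
  rw [hcons]
  have hall : (∀ i ≤ n + 1, 0 ≤ h + pathHeight (Fin.cons s p : Fin (n + 1) → MStep) i) ↔
      ∀ i ≤ n, 0 ≤ h + s.rise + pathHeight p i := by
    constructor
    · intro H i hi
      have := H (i + 1) (by omega)
      rwa [pathHeight_cons_succ, ← add_assoc] at this
    · rintro H (_ | i) hi
      · rwa [pathHeight_zero, add_zero]
      · rw [pathHeight_cons_succ, ← add_assoc]
        exact H i (by omega)
  rw [Fin.prod_univ_succ]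
  simp only [hall, theta_cons_eq_cons, Fin.val_zero, pathHeight_zero, add_zero, Fin.cons_zero,
    Fin.val_succ, pathHeight_cons_succ, Fin.cons_succ, ← add_assoc]
  by_cases hs : s.color = b <;> simp [hs]

theorem weightFrom_eq_wordVec (q : ℝ) {n : ℕ} (X : Config n) (h : ℕ) :
    weightFrom q h X = wordVec q (List.ofFn X) h := by
  induction n generalizing h with
  | zero =>
    simp only [weightFrom, wordVec, List.ofFn_zero]
    have : ∀ p : Fin 0 → MStep, theta p = X := fun p => Subsingleton.elim _ _
    simp [this, pathHeight]
  | succ n ih =>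
    obtain ⟨b, X, rfl⟩ : ∃ b Y, X = Fin.cons b Y := ⟨X 0, Fin.tail X, (Fin.cons_self_tail X).symm⟩
    have hS : ∀ h : ℕ, qInt (h + 1) q = qInt h q + q ^ h := fun h => qInt_succ h q
    rw [weightFrom_cons q (Int.natCast_nonneg h), List.ofFn_succ]
    have huniv : (Finset.univ : Finset MStep) = {MStep.N, MStep.S, MStep.E, MStep.Ebar} := rfl
    have ih' : weightFrom q (h + 1) X = wordVec q (List.ofFn X) (h + 1) := ih X (h + 1)
    have ih'' : weightFrom q (h - 1) X = shiftDown (wordVec q (List.ofFn X)) h := by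
      rcases h with _ | h
      · exact weightFrom_of_neg q (by norm_num) X
      · simpa [shiftDown] using ih X h
    rw [huniv]
    cases b <;> simp [MStep.color, MStep.rise, stepWeight, wordVec, letterOp, ih, ih', ih'', hS,
      ← sub_eq_add_neg] <;> ring

theorem configWeight_eq_wordVec (q : ℝ) {n : ℕ} (X : Config n) :
    configWeight 1 1 q X = wordVec q (List.ofFn X) 0 :=
  (configWeight_eq_weightFrom q X).trans (weightFrom_eq_wordVec q X 0)

theorem configWeight_pos {q : ℝ} (hq : 0 ≤ q) {n : ℕ} (X : Config n) :
    0 < configWeight 1 1 q X := by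
  rw [configWeight_eq_wordVec]
  exact wordVec_zero_pos hq _

theorem partitionFn_pos {q : ℝ} (hq : 0 ≤ q) (n : ℕ) : 0 < partitionFn n 1 1 q :=
  Finset.sum_pos (fun X _ => configWeight_pos hq X) Finset.univ_nonempty

/-! ### The generating function and its `q`-difference operator -/

section GeneratingFunction

variable {A : Type*} [CommRing A]

/-- The column vector `(yD + E) ^ n |0⟩`: every particle is counted with a factor `y`. -/
def totalVec (q y : A) : ℕ → ℕ → A
  | 0 => wordVec q []
  | n + 1 => y • letterOp q true (totalVec q y n) + letterOp q false (totalVec q y n)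

theorem numParticles_cons {n : ℕ} (b : Bool) (X : Config n) :
    numParticles (Fin.cons b X : Fin (n + 1) → Bool) = (if b then 1 else 0) + numParticles X := by
  simp only [numParticles, Finset.card_filter, Fin.sum_univ_succ]
  simp

theorem totalVec_eq_sum (q y : A) (n h : ℕ) :
    totalVec q y n h = ∑ X : Config n, y ^ numParticles X * wordVec q (List.ofFn X) h := by
  induction n generalizing h with
  | zero => simp [totalVec, numParticles]
  | succ n ih =>
    rw [← (Fin.consEquiv fun _ => Bool).sum_comp, Fintype.sum_prod_type]
    have hcons : ∀ b X, (Fin.consEquiv fun _ => Bool) (b, X) =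
      (Fin.cons b X : Fin (n + 1) → Bool) := fun _ _ => rfl
    simp only [hcons, Fintype.sum_bool, numParticles_cons, List.ofFn_succ, Fin.cons_zero,
      Fin.cons_succ, wordVec, totalVec, Pi.add_apply, Pi.smul_apply, smul_eq_mul]
    congr 1
    · simp only [letterOp, if_true, ih, ← Finset.sum_add_distrib, Finset.mul_sum]
      refine Finset.sum_congr rfl fun X _ => ?_
      ring
    · rcases h with _ | h <;>
      · simp only [letterOp, shiftDown, Bool.false_eq_true, if_false, ih, add_zero,
          ← Finset.sum_add_distrib, Finset.mul_sum]
        refine Finset.sum_congr rfl fun X _ => ?_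
        ring

open PowerSeries

/-- The `q`-derivative `x ^ (h + 1) ↦ [h + 1]_q x ^ h` on power series. -/
def qDeriv (q : A) : A⟦X⟧ →ₗ[A] A⟦X⟧ where
  toFun f := PowerSeries.mk fun h => qInt (h + 1) q * coeff (h + 1) f
  map_add' f g := by ext h; simp [mul_add]
  map_smul' c f := by ext h; simp [mul_left_comm]

theorem coeff_qDeriv (q : A) (f : A⟦X⟧) (h : ℕ) :
    coeff h (qDeriv q f) = qInt (h + 1) q * coeff (h + 1) f := by
  simp [qDeriv]

theorem one_sub_mul_X_mul_qDeriv (q : A) (f : A⟦X⟧) :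
    C (1 - q) * (X * qDeriv q f) = f - rescale q f := by
  ext h
  rw [coeff_C_mul, map_sub, coeff_rescale]
  rcases h with _ | h
  · simp
  · rw [coeff_succ_X_mul, coeff_qDeriv, ← mul_assoc, one_sub_mul_qInt]
    ring

/-- The operator `Θ = (1 + x) (1 + y x) Δ`, where `Δ` is the `q`-derivative. -/
def thetaOp (q y : A) : Module.End A A⟦X⟧ :=
  LinearMap.mulLeft A ((1 + X) * (1 + C y * X)) ∘ₗ qDeriv q

theorem thetaOp_apply (q y : A) (f : A⟦X⟧) :
    thetaOp q y f = (1 + X) * (1 + C y * X) * qDeriv q f := rfl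

theorem thetaOp_one (q y : A) : thetaOp q y 1 = 0 := by
  have : qDeriv q (1 : A⟦X⟧) = 0 := by
    ext h
    simp [coeff_qDeriv, coeff_one]
  rw [thetaOp_apply, this, mul_zero]

/-- The generating function of the vector `(yD + E) ^ n |0⟩`, after conjugation by the diagonal
matrix of the powers of `y`, is `Δ Θ ^ n x`. -/
theorem mk_totalVec (q y : A) (n : ℕ) :
    PowerSeries.mk (fun h => y ^ h * totalVec q y n h) = qDeriv q ((thetaOp q y ^ n) X) := by
  induction n with
  | zero =>
    ext h
    rcases h with _ | h <;> simp [totalVec, wordVec, coeff_qDeriv, coeff_X, qInt_one]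
  | succ n ih =>
    rw [pow_succ', Module.End.mul_apply, thetaOp_apply, ← ih]
    ext h
    have hK : ((1 : A⟦X⟧) + X) * (1 + C y * X) = 1 + C (1 + y) * X + C y * (X * X) := by
      simp only [map_add, map_one]
      ring
    rw [coeff_qDeriv, coeff_mk, hK, add_mul, add_mul, one_mul, mul_assoc, mul_assoc, map_add,
      map_add, coeff_C_mul, coeff_C_mul, coeff_succ_X_mul, mul_assoc, coeff_succ_X_mul]
    rcases h with _ | h
    · simp [totalVec, letterOp, shiftDown]
      ring
    · rw [coeff_succ_X_mul]
      simp [totalVec, letterOp, shiftDown]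
      ring

theorem totalVec_zero_eq (q y : A) (n : ℕ) :
    totalVec q y n 0 = constantCoeff ((thetaOp q y ^ (n + 1)) X) := by
  have h := congrArg (coeff 0) (mk_totalVec q y n)
  rw [coeff_mk, pow_zero, one_mul] at h
  rw [h, pow_succ', Module.End.mul_apply, thetaOp_apply]
  simp

/-! ### Eigenfunctions -/

/-- The product `∏_{i < j} (1 + q ^ i x)`. -/
def eigenNum (q : A) (j : ℕ) : A⟦X⟧ := ∏ i ∈ Finset.range j, (1 + C (q ^ i) * X)

/-- The product `∏_{1 ≤ i ≤ j} (1 + y u ^ i x)`; here `u` stands for the inverse of `q`. -/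
def eigenDen (u y : A) (j : ℕ) : A⟦X⟧ := ∏ i ∈ Finset.range j, (1 + C (y * u ^ (i + 1)) * X)

/-- The inverse of `eigenDen` as a power series. -/
def eigenDenInv (u y : A) (j : ℕ) : A⟦X⟧ := invOfUnit (eigenDen u y j) 1

/-- The eigenfunction `∏_{i < j} (1 + q ^ i x) / ∏_{1 ≤ i ≤ j} (1 + y u ^ i x)` of `Θ`. -/
def eigenFun (q u y : A) (j : ℕ) : A⟦X⟧ := eigenNum q j * eigenDenInv u y j

theorem eigenNum_succ (q : A) (j : ℕ) :
    eigenNum q (j + 1) = eigenNum q j * (1 + C (q ^ j) * X) :=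
  Finset.prod_range_succ _ _

theorem eigenDen_succ (u y : A) (j : ℕ) :
    eigenDen u y (j + 1) = eigenDen u y j * (1 + C (y * u ^ (j + 1)) * X) :=
  Finset.prod_range_succ _ _

theorem constantCoeff_eigenNum (q : A) (j : ℕ) : constantCoeff (eigenNum q j) = 1 := by
  simp [eigenNum, map_prod]

theorem constantCoeff_eigenDen (u y : A) (j : ℕ) : constantCoeff (eigenDen u y j) = 1 := by
  simp [eigenDen, map_prod]

theorem eigenDen_mul_inv (u y : A) (j : ℕ) : eigenDen u y j * eigenDenInv u y j = 1 :=
  mul_invOfUnit _ _ (by simp [constantCoeff_eigenDen])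

theorem constantCoeff_eigenFun (q u y : A) (j : ℕ) : constantCoeff (eigenFun q u y j) = 1 := by
  simp [eigenFun, constantCoeff_eigenNum, eigenDenInv]

theorem eigenDenInv_eq_succ_mul (u y : A) (j : ℕ) :
    eigenDenInv u y j = eigenDenInv u y (j + 1) * (1 + C (y * u ^ (j + 1)) * X) := by
  have h := eigenDen_mul_inv u y (j + 1)
  rw [eigenDen_succ] at h
  linear_combination (-eigenDenInv u y j) * h +
    (1 + C (y * u ^ (j + 1)) * X) * eigenDenInv u y (j + 1) * eigenDen_mul_inv u y j

theorem rescale_one_add (q a : A) :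
    rescale q (1 + C a * X : A⟦X⟧) = 1 + C (q * a) * X := by
  ext h
  rw [coeff_rescale, map_add, map_add, coeff_C_mul, coeff_C_mul]
  rcases h with _ | _ | h <;> simp [coeff_one, coeff_X]

theorem rescale_eigenNum (q : A) (j : ℕ) :
    rescale q (eigenNum q j) * (1 + X) = eigenNum q j * (1 + C (q ^ j) * X) := by
  induction j with
  | zero => simp [eigenNum]
  | succ j ih =>
    rw [eigenNum_succ, map_mul, rescale_one_add, ← pow_succ', ← ih]
    ring

theorem rescale_eigenDen {q u : A} (hqu : q * u = 1) (y : A) (j : ℕ) :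
    rescale q (eigenDen u y j) * (1 + C (y * u ^ j) * X) = eigenDen u y j * (1 + C y * X) := by
  induction j with
  | zero => simp [eigenDen]
  | succ j ih =>
    have : q * (y * u ^ (j + 1)) = y * u ^ j := by
      linear_combination y * u ^ j * hqu
    rw [eigenDen_succ, map_mul, rescale_one_add, this, ih]
    ring

theorem rescale_eigenFun {q u : A} (hqu : q * u = 1) (y : A) (j : ℕ) :
    (1 + X) * (1 + C y * X) * rescale q (eigenFun q u y j) =
      (1 + C (q ^ j) * X) * (1 + C (y * u ^ j) * X) * eigenFun q u y j := by
  have hN := rescale_eigenNum q j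
  have hD := rescale_eigenDen hqu y j
  have h1 := eigenDen_mul_inv u y j
  have h2 := congrArg (rescale q) h1
  rw [map_mul, map_one] at h2
  rw [eigenFun, map_mul]
  set P := eigenNum q j
  set Q := eigenDen u y j
  set I := eigenDenInv u y j
  linear_combination (1 + C y * X) * rescale q I * hN
    - (1 + C (q ^ j) * X) * P * I * rescale q I * hD
    - (1 + C (q ^ j) * X) * P * rescale q I * (1 + C y * X) * h1
    + (1 + C (q ^ j) * X) * P * I * (1 + C (y * u ^ j) * X) * h2

theorem thetaOp_eigenFun [IsDomain A] {q u : A} (hqu : q * u = 1) (hq : q ≠ 1) (y : A) (j : ℕ) :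
    thetaOp q y (eigenFun q u y j) = (qInt j q * (1 - y * u ^ j)) • eigenFun q u y j := by
  have hX : (C (1 - q) * X : A⟦X⟧) ≠ 0 := by
    refine mul_ne_zero ?_ X_ne_zero
    rw [Ne, map_eq_zero_iff _ C_injective, sub_eq_zero]
    exact hq.symm
  refine mul_left_cancel₀ hX ?_
  have hd := one_sub_mul_X_mul_qDeriv q (eigenFun q u y j)
  have hr := rescale_eigenFun hqu y j
  have hi := congrArg (C (R := A)) (one_sub_mul_qInt j q)
  have hju : (C (q ^ j) : A⟦X⟧) * C (u ^ j) = 1 := by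
    rw [← map_mul, ← mul_pow, hqu, one_pow, map_one]
  rw [thetaOp_apply, smul_eq_C_mul]
  set g := eigenFun q u y j
  simp only [map_mul, map_sub, map_one] at hr hi hd hju ⊢
  linear_combination (1 + X) * (1 + C y * X) * hd - hr - X * (1 - C y * C (u ^ j)) * g * hi
    - C y * X * X * g * hju - C y * X * g * hju

/-- The coefficient of the `j + 1`-st eigenfunction in the expansion of `1 + x`. -/
def eigenCoeff (u y : A) (j : ℕ) : A := y ^ j * u ^ (j * (j + 1)) * (1 - y * u ^ (2 * (j + 1)))

/-- The expansion of `1 + x` in eigenfunctions telescopes, up to a multiple of `y ^ J`. -/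
theorem one_add_X_eq_sum {q u : A} (hqu : q * u = 1) (y : A) (J : ℕ) :
    (1 + X : A⟦X⟧) = ∑ j ∈ Finset.range J, eigenCoeff u y j • eigenFun q u y (j + 1) +
      (y ^ J * u ^ (J * (J + 1))) • (eigenNum q (J + 1) * eigenDenInv u y J) := by
  induction J with
  | zero =>
    have h := eigenDen_mul_inv u y 0
    simp only [eigenDen, Finset.range_zero, Finset.prod_empty, one_mul] at h
    simp [eigenNum, h]
  | succ J ih =>
    have hju : (C (q ^ (J + 1)) : A⟦X⟧) * C (u ^ (J + 1)) = 1 := by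
      rw [← map_mul, ← mul_pow, hqu, one_pow, map_one]
    have e1 : u ^ ((J + 1) * (J + 1 + 1)) = u ^ (J * (J + 1)) * (u ^ (J + 1) * u ^ (J + 1)) := by
      ring
    have e2 : u ^ (2 * (J + 1)) = u ^ (J + 1) * u ^ (J + 1) := by ring
    rw [Finset.sum_range_succ, ih, add_assoc, add_right_inj, eigenNum_succ q (J + 1),
      eigenDenInv_eq_succ_mul u y J, eigenCoeff, eigenFun, e1, e2]
    simp only [smul_eq_C_mul, map_mul, map_sub, map_one, pow_succ y J]
    linear_combination (-(C (y ^ J) * C y * C (u ^ (J * (J + 1))) * C (u ^ (J + 1)) * X *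
      eigenNum q (J + 1) * eigenDenInv u y (J + 1))) * hju

/-- The spectral formula for the generating function of all paths of length `n`, up to a multiple
of `y ^ J`. -/
theorem exists_totalVec_zero_eq_sum [IsDomain A] {q u : A} (hqu : q * u = 1) (hq : q ≠ 1) (y : A)
    (n J : ℕ) : ∃ r : A, totalVec q y n 0 =
      ∑ j ∈ Finset.range J,
        eigenCoeff u y j * (qInt (j + 1) q * (1 - y * u ^ (j + 1))) ^ (n + 1) + y ^ J * r := by
  have hpow : ∀ (m j : ℕ), (thetaOp q y ^ m) (eigenFun q u y j) =
      (qInt j q * (1 - y * u ^ j)) ^ m • eigenFun q u y j := by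
    intro m j
    induction m with
    | zero => simp
    | succ m ih =>
      rw [pow_succ', Module.End.mul_apply, ih, map_smul, thetaOp_eigenFun hqu hq, smul_smul,
        pow_succ]
  have hX : (thetaOp q y ^ (n + 1)) X = (thetaOp q y ^ (n + 1)) (1 + X) := by
    rw [map_add, pow_succ, Module.End.mul_apply, Module.End.mul_apply, thetaOp_one, map_zero,
      zero_add]
  refine ⟨u ^ (J * (J + 1)) * constantCoeff
    ((thetaOp q y ^ (n + 1)) (eigenNum q (J + 1) * eigenDenInv u y J)), ?_⟩
  rw [totalVec_zero_eq, hX, one_add_X_eq_sum hqu y J]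
  simp only [map_add, map_sum, map_smul, hpow]
  simp only [smul_eq_C_mul, map_mul, constantCoeff_C, constantCoeff_eigenFun, mul_one, mul_assoc]

end GeneratingFunction

/-! ### The `q`-Eulerian numbers as coefficients -/

section Coefficients

open Polynomial

theorem coeff_one_sub_X_mul_C_pow {R : Type*} [CommRing R] (a : R) (N i : ℕ) :
    ((1 - X * C a) ^ N : R[X]).coeff i = (-1) ^ i * a ^ i * (N.choose i : R) := by
  have h : (1 - X * C a : R[X]) = C (-a) * X + 1 := by
    rw [map_neg]
    ring
  rw [h, add_pow, finsetSum_coeff]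
  have hterm : ∀ m, ((C (-a) * X : R[X]) ^ m * 1 ^ (N - m) * (N.choose m : R[X])).coeff i =
      if i = m then (-1) ^ i * a ^ i * (N.choose i : R) else 0 := by
    intro m
    rw [one_pow, mul_one, mul_pow, ← C_pow, ← C_eq_natCast, mul_assoc, mul_comm (X ^ m),
      ← mul_assoc, ← C_mul, coeff_C_mul_X_pow]
    split_ifs with him
    · rw [him, neg_pow]
    · rfl
  simp only [hterm, Finset.sum_ite_eq, Finset.mem_range]
  split_ifs with hi
  · rfl
  · rw [Nat.choose_eq_zero_of_lt (by omega)]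
    simp

theorem coeff_eigenCoeff_mul {R : Type*} [CommRing R] (u b : R) (j i N : ℕ) :
    (eigenCoeff (C u) X j * (C b * (1 - X * C u ^ (j + 1))) ^ N : R[X]).coeff (i + j) =
      (-1) ^ i * b ^ N * u ^ ((j + 1) * j + (j + 1) * i) *
        ((N.choose i : R) + u ^ (j + 1) * (choosePred N i : R)) := by
  have h : (eigenCoeff (C u) X j * (C b * (1 - X * C u ^ (j + 1))) ^ N : R[X]) =
      C (u ^ (j * (j + 1)) * b ^ N) * ((1 - X * C (u ^ (j + 1))) ^ N) * X ^ j -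
      C (u ^ (j * (j + 1)) * b ^ N * u ^ (2 * (j + 1))) *
        ((1 - X * C (u ^ (j + 1))) ^ N * X) * X ^ j := by
    rw [eigenCoeff, mul_pow (C b)]
    simp only [C_mul, C_pow]
    ring
  rw [h, coeff_sub, coeff_mul_X_pow, coeff_mul_X_pow, coeff_C_mul, coeff_C_mul,
    coeff_one_sub_X_mul_C_pow]
  rcases i with _ | i
  · simp [choosePred]
    ring
  · rw [coeff_mul_X, coeff_one_sub_X_mul_C_pow]
    simp only [choosePred, Nat.add_sub_cancel, Nat.succ_ne_zero, if_false]
    ring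

open LaurentPolynomial in
/-- The weights of the configurations with `k` particles add up to the `q`-Eulerian number, with
`q` an indeterminate. -/
theorem sum_wordVec_T_eq_qEulerianLaurent {n k : ℕ} :
    ∑ Y : Config n with numParticles Y = k, wordVec (T 1 : ℤ[T;T⁻¹]) (List.ofFn Y) 0 =
      qEulerianLaurent (k + 1) (n + 1) := by
  have hT : (T 1 : ℤ[T;T⁻¹]) * T (-1) = 1 := by rw [← T_add]; simp
  have hT1 : (T 1 : ℤ[T;T⁻¹]) ≠ 1 := by
    rw [← Polynomial.toLaurent_X, ← map_one Polynomial.toLaurent]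
    exact fun h => Polynomial.X_ne_C 1 (Polynomial.toLaurent_injective h)
  have hCT : (Polynomial.C (T 1 : ℤ[T;T⁻¹])) * Polynomial.C (T (-1)) = 1 := by
    rw [← Polynomial.C_mul, hT, Polynomial.C_1]
  have hC1 : (Polynomial.C (T 1 : ℤ[T;T⁻¹])) ≠ 1 := by
    rw [← Polynomial.C_1]
    exact fun h => hT1 (Polynomial.C_injective h)
  obtain ⟨r, hr⟩ := exists_totalVec_zero_eq_sum hCT hC1 Polynomial.X n (k + 1)
  have hk := congrArg (fun f => Polynomial.coeff f k) hr
  simp only [totalVec_eq_sum, Polynomial.coeff_add, Polynomial.finsetSum_coeff,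
    ← map_wordVec Polynomial.C, Polynomial.coeff_X_pow_mul', ← map_qInt Polynomial.C] at hk
  rw [if_neg (by omega), add_zero] at hk
  have hl : ∀ Y : Config n,
      (if numParticles Y ≤ k then (Polynomial.C (wordVec (T 1 : ℤ[T;T⁻¹]) (List.ofFn Y) 0)).coeff
        (k - numParticles Y) else 0) =
      if numParticles Y = k then wordVec (T 1 : ℤ[T;T⁻¹]) (List.ofFn Y) 0 else 0 := by
    intro Y
    rw [Polynomial.coeff_C]
    split_ifs <;> first | rfl | omega
  rw [Finset.sum_filter, ← Finset.sum_congr rfl fun Y _ => hl Y, hk, qEulerianLaurent,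
    Finset.mul_sum, ← Finset.sum_range_reflect]
  refine Finset.sum_congr rfl fun i hi => ?_
  rw [Finset.mem_range] at hi
  obtain ⟨j, rfl⟩ : ∃ j, k = i + j := ⟨k - i, by omega⟩
  have e1 : i + j + 1 - 1 - i = j := by omega
  have e2 : i + j + 1 - i = j + 1 := by omega
  rw [e1, e2, coeff_eigenCoeff_mul, T_pow, T_pow]
  have e3 : (T (((i + j + 1 : ℕ) : ℤ) - ((i + j + 1 : ℕ) : ℤ) ^ 2) : ℤ[T;T⁻¹]) *
      (T (((i + j + 1 : ℕ) : ℤ) * ((i : ℤ) - 1)) * T (((i + j + 1 : ℕ) : ℤ) - (i : ℤ))) =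
      T ((((j + 1) * j + (j + 1) * i : ℕ) : ℤ) * -1) := by
    rw [← T_add, ← T_add]
    congr 1
    push_cast
    ring
  have e4 : (T (((i + j + 1 : ℕ) : ℤ) - ((i + j + 1 : ℕ) : ℤ) ^ 2) : ℤ[T;T⁻¹]) *
      T (((i + j + 1 : ℕ) : ℤ) * ((i : ℤ) - 1)) =
      T ((((j + 1) * j + (j + 1) * i : ℕ) : ℤ) * -1) * T (((j + 1 : ℕ) : ℤ) * -1) := by
    rw [← T_add, ← T_add]
    congr 1
    push_cast
    ring
  linear_combination (-((-1) ^ i * qInt (j + 1) (T 1 : ℤ[T;T⁻¹]) ^ (n + 1) *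
      ((n + 1).choose i : ℤ[T;T⁻¹]))) * e3 -
    (-1) ^ i * qInt (j + 1) (T 1 : ℤ[T;T⁻¹]) ^ (n + 1) *
      (choosePred (n + 1) i : ℤ[T;T⁻¹]) * e4

/-- The `q`-Eulerian number as a polynomial, without division. -/
theorem toLaurent_sum_wordVec_X (n k : ℕ) :
    toLaurent (∑ Y : Config n with numParticles Y = k, wordVec (X : ℤ[X]) (List.ofFn Y) 0) =
      qEulerianLaurent (k + 1) (n + 1) := by
  rw [← sum_wordVec_T_eq_qEulerianLaurent, map_sum]
  refine Finset.sum_congr rfl fun Y _ => ?_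
  have := map_wordVec (toLaurent : ℤ[X] →+* ℤ[T;T⁻¹]) X (List.ofFn Y) 0
  rwa [toLaurent_X] at this

theorem qEulerian_eq_sum_wordVec (n k : ℕ) : qEulerian (k + 1) (n + 1) =
    ∑ Y : Config n with numParticles Y = k, wordVec (X : ℤ[X]) (List.ofFn Y) 0 := by
  rw [qEulerian, ← toLaurent_sum_wordVec_X, trunc_toLaurent]

theorem toLaurent_qEulerian (n k : ℕ) :
    toLaurent (qEulerian (k + 1) (n + 1)) = qEulerianLaurent (k + 1) (n + 1) := by
  rw [qEulerian_eq_sum_wordVec, toLaurent_sum_wordVec_X]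

theorem aeval_qEulerian (q : ℝ) (n k : ℕ) : aeval q (qEulerian (k + 1) (n + 1)) =
    ∑ Y : Config n with numParticles Y = k, configWeight 1 1 q Y := by
  rw [qEulerian_eq_sum_wordVec, map_sum]
  refine Finset.sum_congr rfl fun Y _ => ?_
  have := map_wordVec (aeval q : ℤ[X] →ₐ[ℤ] ℝ).toRingHom X (List.ofFn Y) 0
  rw [configWeight_eq_wordVec]
  simpa using this

end Coefficients

/-! ### The jumps of the chain -/

/-- The configuration with the letters of the sites `i` and `i + 1` exchanged. -/
def swapAt {m : ℕ} (i : Fin m) (X : Config (m + 1)) : Config (m + 1) :=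
  X ∘ Equiv.swap i.castSucc i.succ

theorem swapAt_castSucc {m : ℕ} (i : Fin m) (X : Config (m + 1)) :
    swapAt i X i.castSucc = X i.succ := by simp [swapAt]

theorem swapAt_succ {m : ℕ} (i : Fin m) (X : Config (m + 1)) :
    swapAt i X i.succ = X i.castSucc := by simp [swapAt]

theorem swapAt_of_ne {m : ℕ} {i : Fin m} (X : Config (m + 1)) {l : Fin (m + 1)}
    (h1 : l ≠ i.castSucc) (h2 : l ≠ i.succ) : swapAt i X l = X l := by
  simp [swapAt, Equiv.swap_apply_of_ne_of_ne h1 h2]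

theorem swapAt_swapAt {m : ℕ} (i : Fin m) (X : Config (m + 1)) : swapAt i (swapAt i X) = X := by
  funext l
  simp [swapAt]

theorem hopsRight_iff {m : ℕ} {X Y : Config (m + 1)} : HopsRight X Y ↔
    ∃ i : Fin m, X i.castSucc = true ∧ X i.succ = false ∧ Y = swapAt i X := by
  constructor
  · rintro ⟨i, j, hij, hi, hj, hYi, hYj, hl⟩
    obtain ⟨i, rfl⟩ : ∃ k : Fin m, i = k.castSucc := ⟨⟨i.val, by omega⟩, rfl⟩
    obtain rfl : j = i.succ := Fin.ext hij
    refine ⟨i, hi, hj, funext fun l => ?_⟩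
    by_cases h1 : l = i.castSucc
    · rw [h1, hYi, swapAt_castSucc, hj]
    by_cases h2 : l = i.succ
    · rw [h2, hYj, swapAt_succ, hi]
    rw [hl l h1 h2, swapAt_of_ne X h1 h2]
  · rintro ⟨i, h1, h2, rfl⟩
    exact ⟨i.castSucc, i.succ, by simp, h1, h2, by rw [swapAt_castSucc, h2],
      by rw [swapAt_succ, h1], fun l hl1 hl2 => swapAt_of_ne X hl1 hl2⟩

theorem hopsRight_iff' {m : ℕ} {X Y : Config (m + 1)} : HopsRight X Y ↔
    ∃ i : Fin m, Y i.castSucc = false ∧ Y i.succ = true ∧ X = swapAt i Y := by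
  rw [hopsRight_iff]
  constructor
  · rintro ⟨i, h1, h2, rfl⟩
    exact ⟨i, by rw [swapAt_castSucc, h2], by rw [swapAt_succ, h1], (swapAt_swapAt i X).symm⟩
  · rintro ⟨i, h1, h2, rfl⟩
    exact ⟨i, by rw [swapAt_castSucc, h2], by rw [swapAt_succ, h1], (swapAt_swapAt i Y).symm⟩

theorem enters_iff {m : ℕ} {X Y : Config (m + 1)} :
    Enters X Y ↔ X 0 = false ∧ Y = Function.update X 0 true := by
  constructor
  · rintro ⟨i, hi, hX, hY, hl⟩
    obtain rfl : i = 0 := Fin.ext hi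
    exact ⟨hX, Function.eq_update_iff.2 ⟨hY, hl⟩⟩
  · rintro ⟨h, rfl⟩
    exact ⟨0, rfl, h, by simp, fun l hl => Function.update_of_ne hl _ _⟩

theorem enters_iff' {m : ℕ} {X Y : Config (m + 1)} :
    Enters X Y ↔ Y 0 = true ∧ X = Function.update Y 0 false := by
  rw [enters_iff]
  constructor
  · rintro ⟨h, rfl⟩
    exact ⟨by simp, by simp [← h]⟩
  · rintro ⟨h, rfl⟩
    exact ⟨by simp, by simp [← h]⟩

theorem exits_iff {m : ℕ} {X Y : Config (m + 1)} :
    Exits X Y ↔ X (Fin.last m) = true ∧ Y = Function.update X (Fin.last m) false := by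
  constructor
  · rintro ⟨i, hi, hX, hY, hl⟩
    obtain rfl : i = Fin.last m := Fin.ext (by simpa using hi)
    exact ⟨hX, Function.eq_update_iff.2 ⟨hY, hl⟩⟩
  · rintro ⟨h, rfl⟩
    exact ⟨Fin.last m, rfl, h, by simp, fun l hl => Function.update_of_ne hl _ _⟩

theorem exits_iff' {m : ℕ} {X Y : Config (m + 1)} :
    Exits X Y ↔ Y (Fin.last m) = false ∧ X = Function.update Y (Fin.last m) true := by
  rw [exits_iff]
  constructor
  · rintro ⟨h, rfl⟩
    exact ⟨by simp, by simp [← h]⟩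
  · rintro ⟨h, rfl⟩
    exact ⟨by simp, by simp [← h]⟩

/-- The sum of `f i` over the occupied sites `i`. -/
def siteSum {n : ℕ} (f : ℕ → ℕ) (X : Config n) : ℕ := ∑ i : Fin n, if X i then f i else 0

theorem siteSum_hopsRight {n : ℕ} (f : ℕ → ℕ) {X Y : Config n} (h : HopsRight X Y) :
    ∃ i, i + 1 < n ∧ siteSum f X + f (i + 1) = siteSum f Y + f i := by
  obtain ⟨i, j, hij, hXi, hXj, hYi, hYj, hl⟩ := h
  have hne : i ≠ j := fun h => by rw [h] at hij; omega
  refine ⟨i, by omega, ?_⟩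
  have hji : j ∈ Finset.univ.erase i := Finset.mem_erase.2 ⟨hne.symm, Finset.mem_univ _⟩
  unfold siteSum
  rw [← Finset.add_sum_erase _ _ (Finset.mem_univ i), ← Finset.add_sum_erase _ _ hji,
    ← Finset.add_sum_erase Finset.univ _ (Finset.mem_univ i), ← Finset.add_sum_erase _ _ hji]
  have : ∀ l ∈ (Finset.univ.erase i).erase j,
      (if X l then f l else 0) = if Y l then f l else 0 := by
    intro l hlm
    simp only [Finset.mem_erase] at hlm
    rw [hl l hlm.2.1 hlm.1]
  rw [Finset.sum_congr rfl this]
  simp [hXi, hXj, hYi, hYj, hij]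
  omega

theorem siteSum_of_update {n : ℕ} (f : ℕ → ℕ) {X Y : Config n} (i : Fin n) (hX : X i = false)
    (hY : Y i = true) (hl : ∀ l, l ≠ i → Y l = X l) : siteSum f Y = siteSum f X + f i := by
  unfold siteSum
  rw [← Finset.add_sum_erase _ _ (Finset.mem_univ i),
    ← Finset.add_sum_erase Finset.univ _ (Finset.mem_univ i)]
  have : ∀ l ∈ Finset.univ.erase i, (if Y l then f l else 0) = if X l then f l else 0 := by
    intro l hlm
    rw [hl l (Finset.ne_of_mem_erase hlm)]
  rw [Finset.sum_congr rfl this]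
  simp [hX, hY]
  omega

theorem siteSum_enters {n : ℕ} (f : ℕ → ℕ) {X Y : Config n} (h : Enters X Y) :
    siteSum f Y = siteSum f X + f 0 := by
  obtain ⟨i, hi, hX, hY, hl⟩ := h
  rw [← hi]
  exact siteSum_of_update f i hX hY hl

theorem siteSum_exits {n : ℕ} (f : ℕ → ℕ) {X Y : Config n} (h : Exits X Y) :
    siteSum f X = siteSum f Y + f (n - 1) := by
  obtain ⟨i, hi, hX, hY, hl⟩ := h
  have : n - 1 = i.val := by omega
  rw [this]
  exact siteSum_of_update f i hY hX fun l hne => (hl l hne).symm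

open Classical in
/-- The four kinds of jumps exclude one another, so that the jump probabilities are additive in
them. -/
theorem mul_jumpProb {n : ℕ} (q : ℝ) (X Y : Config n) :
    ((n : ℝ) + 1) * jumpProb 1 1 q X Y = (if HopsRight X Y then 1 else 0) +
      q * (if HopsRight Y X then 1 else 0) + (if Enters X Y then 1 else 0) +
      (if Exits X Y then 1 else 0) := by
  have hn : (n : ℝ) + 1 ≠ 0 := by positivity
  -- Hops preserve the number of particles and shift the sum of their positions by one.
  have h1 : ∀ {U V : Config n}, HopsRight U V → siteSum (fun _ => 1) U = siteSum (fun _ => 1) V ∧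
      siteSum id V = siteSum id U + 1 := fun h => by
    obtain ⟨_, -, h1⟩ := siteSum_hopsRight (fun _ => 1) h
    obtain ⟨i, -, h2⟩ := siteSum_hopsRight id h
    simp only [id] at h2
    omega
  have h2 : Enters X Y → siteSum (fun _ => 1) Y = siteSum (fun _ => 1) X + 1 :=
    fun h => siteSum_enters _ h
  have h3 : Exits X Y → siteSum (fun _ => 1) X = siteSum (fun _ => 1) Y + 1 :=
    fun h => siteSum_exits _ h
  unfold jumpProb
  by_cases a : HopsRight X Y
  · have b : ¬ HopsRight Y X := fun b => by have := h1 a; have := h1 b; omega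
    have c : ¬ Enters X Y := fun c => by have := h1 a; have := h2 c; omega
    have d : ¬ Exits X Y := fun d => by have := h1 a; have := h3 d; omega
    simp [a, b, c, d, hn]
  by_cases b : HopsRight Y X
  · have c : ¬ Enters X Y := fun c => by have := h1 b; have := h2 c; omega
    have d : ¬ Exits X Y := fun d => by have := h1 b; have := h3 d; omega
    simp [a, b, c, d]
    field_simp
  by_cases c : Enters X Y
  · have d : ¬ Exits X Y := fun d => by have := h2 c; have := h3 d; omega
    simp [a, b, c, d, hn]
  by_cases d : Exits X Y <;> simp [a, b, c, d, hn]

theorem jumpProb_self {n : ℕ} (q : ℝ) (X : Config n) : jumpProb 1 1 q X X = 0 := by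
  have h1 : ¬ HopsRight X X := by
    rintro ⟨i, j, -, h1, -, h2, -⟩
    simp [h1] at h2
  have h2 : ¬ Enters X X := by
    rintro ⟨i, -, h1, h2, -⟩
    simp [h1] at h2
  have h3 : ¬ Exits X X := by
    rintro ⟨i, -, h1, h2, -⟩
    simp [h1] at h2
  simp [jumpProb, h1, h2, h3]

theorem jumpProb_nonneg {n : ℕ} {q : ℝ} (hq : 0 ≤ q) (X Y : Config n) :
    0 ≤ jumpProb 1 1 q X Y := by
  unfold jumpProb
  split_ifs <;> positivity

/-! ### Global balance -/

/-- The global balance equations: the flow into every state equals the flow out of it. -/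
def IsBalanced {S : Type*} [Fintype S] (r : S → S → ℝ) (f : S → ℝ) : Prop :=
  ∀ Y, ∑ X, f X * r X Y = f Y * ∑ X, r Y X

theorem vecMul_asep_eq_iff {n : ℕ} (q : ℝ) (f : Config n → ℝ) :
    f ᵥ* asep n 1 1 q = f ↔ IsBalanced (jumpProb 1 1 q) f := by
  classical
  rw [funext_iff]
  refine forall_congr' fun Y => ?_
  have h : ∀ X, f X * asep n 1 1 q X Y =
      f X * jumpProb 1 1 q X Y +
        if X = Y then f Y * (1 - ∑ Z, jumpProb 1 1 q Y Z) else 0 := by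
    intro X
    unfold asep
    have he : ∑ Z ∈ Finset.univ.erase X, jumpProb 1 1 q X Z = ∑ Z, jumpProb 1 1 q X Z :=
      Finset.sum_erase _ (jumpProb_self q X)
    split_ifs with hXY
    · subst hXY
      rw [he, jumpProb_self]
      ring
    · ring
  rw [Matrix.vecMul, dotProduct, Finset.sum_congr rfl fun X _ => h X, Finset.sum_add_distrib,
    Finset.sum_ite_eq' Finset.univ Y, if_pos (Finset.mem_univ _)]
  constructor <;> intro h <;> linarith

/-- The sign of a letter in the telescoping form of the balance equations. -/
def letterSign (b : Bool) : ℝ := if b then -1 else 1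

/-- The matrix ansatz turns the net flow through a bond into a difference of the weights of the
words with one of its two letters deleted. -/
theorem bond_flow (q : ℝ) (A B : List Bool) (a b : Bool) :
    (if a = false ∧ b = true then wordVec q (A ++ b :: a :: B) 0 else 0) +
      q * (if a = true ∧ b = false then wordVec q (A ++ b :: a :: B) 0 else 0) -
      wordVec q (A ++ a :: b :: B) 0 * ((if a = true ∧ b = false then 1 else 0) +
        q * (if a = false ∧ b = true then 1 else 0)) =
    letterSign a * wordVec q (A ++ b :: B) 0 - letterSign b * wordVec q (A ++ a :: B) 0 := by
  have h := congrFun (wordVec_append_true_false q A B) 0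
  simp only [Pi.add_apply, Pi.smul_apply, smul_eq_mul] at h
  cases a <;> cases b <;> simp [letterSign, h] <;> ring

theorem ofFn_eq_take_append {m : ℕ} (i : Fin m) (Y : Config (m + 1)) :
    List.ofFn Y = (List.ofFn Y).take i ++
      Y i.castSucc :: Y i.succ :: (List.ofFn Y).drop (i + 2) := by
  conv_lhs => rw [← List.take_append_drop i (List.ofFn Y)]
  rw [List.drop_eq_getElem_cons (by simp), List.drop_eq_getElem_cons (by simp)]
  simp [-List.ofFn_succ, Fin.castSucc, Fin.succ, Fin.castAdd, Fin.castLE]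

theorem ofFn_swapAt {m : ℕ} (i : Fin m) (Y : Config (m + 1)) :
    List.ofFn (swapAt i Y) = (List.ofFn Y).take i ++
      Y i.succ :: Y i.castSucc :: (List.ofFn Y).drop (i + 2) := by
  rw [ofFn_eq_take_append i (swapAt i Y), swapAt_castSucc, swapAt_succ]
  congr 1
  · refine List.ext_getElem (by simp) fun k h1 h2 => ?_
    simp only [List.length_take, List.length_ofFn] at h1
    simp only [List.getElem_take, List.getElem_ofFn]
    exact swapAt_of_ne Y (by simp [Fin.ext_iff]; omega) (by simp [Fin.ext_iff]; omega)
  · congr 2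
    refine List.ext_getElem (by simp) fun k h1 h2 => ?_
    simp only [List.getElem_drop, List.getElem_ofFn]
    exact swapAt_of_ne Y (by simp [Fin.ext_iff]; omega) (by simp [Fin.ext_iff]; omega)

/-- The weight of the word of `Y` with the letter at `k` deleted, with the sign of that letter. -/
def deletedWeight (q : ℝ) {n : ℕ} (Y : Config n) (k : Fin n) : ℝ :=
  letterSign (Y k) * wordVec q ((List.ofFn Y).take k ++ (List.ofFn Y).drop (k + 1)) 0

theorem bond_flow_eq_deletedWeight (q : ℝ) {m : ℕ} (Y : Config (m + 1)) (i : Fin m) :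
    (if Y i.castSucc = false ∧ Y i.succ = true then
        wordVec q (List.ofFn (swapAt i Y)) 0 else 0) +
      q * (if Y i.castSucc = true ∧ Y i.succ = false then
        wordVec q (List.ofFn (swapAt i Y)) 0 else 0) -
      wordVec q (List.ofFn Y) 0 * ((if Y i.castSucc = true ∧ Y i.succ = false then 1 else 0) +
        q * (if Y i.castSucc = false ∧ Y i.succ = true then 1 else 0)) =
    deletedWeight q Y i.castSucc - deletedWeight q Y i.succ := by
  have h := bond_flow q ((List.ofFn Y).take i) ((List.ofFn Y).drop (i + 2))
    (Y i.castSucc) (Y i.succ)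
  rw [← ofFn_eq_take_append, ← ofFn_swapAt] at h
  rw [h, deletedWeight, deletedWeight]
  congr 3
  · rw [Fin.val_castSucc, List.drop_eq_getElem_cons (i := i + 1) (by simp)]
    simp [-List.ofFn_succ, Fin.succ]
  · rw [Fin.val_succ, List.take_succ_eq_append_getElem (by simp)]
    simp [-List.ofFn_succ, Fin.castSucc, Fin.castAdd, Fin.castLE]

theorem left_flow (q : ℝ) {m : ℕ} (Y : Config (m + 1)) :
    (if Y 0 = true then wordVec q (List.ofFn (Function.update Y 0 false)) 0 else 0) -
      wordVec q (List.ofFn Y) 0 * (if Y 0 = false then 1 else 0) = -deletedWeight q Y 0 := by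
  have h : ∀ b, wordVec q (List.ofFn (Function.update Y 0 b)) 0 =
      wordVec q (b :: List.ofFn fun i : Fin m => Y i.succ) 0 := by
    intro b
    rw [List.ofFn_succ]
    simp
  have hd : deletedWeight q Y 0 =
      letterSign (Y 0) * wordVec q (List.ofFn fun i : Fin m => Y i.succ) 0 := by
    rw [deletedWeight, List.ofFn_succ]
    simp
  have h0 := h (Y 0)
  rw [Function.update_eq_self] at h0
  rw [h, h0, hd, wordVec_false_cons_zero]
  cases hY : Y 0 <;> simp [letterSign, wordVec_false_cons_zero]

theorem right_flow (q : ℝ) {m : ℕ} (Y : Config (m + 1)) :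
    (if Y (Fin.last m) = false then
        wordVec q (List.ofFn (Function.update Y (Fin.last m) true)) 0 else 0) -
      wordVec q (List.ofFn Y) 0 * (if Y (Fin.last m) = true then 1 else 0) =
    deletedWeight q Y (Fin.last m) := by
  have h : ∀ b, wordVec q (List.ofFn (Function.update Y (Fin.last m) b)) 0 =
      wordVec q ((List.ofFn fun i : Fin m => Y i.castSucc) ++ [b]) 0 := by
    intro b
    rw [List.ofFn_succ', List.concat_eq_append]
    simp [Fin.castSucc_ne_last]
  have hd : deletedWeight q Y (Fin.last m) =
      letterSign (Y (Fin.last m)) * wordVec q (List.ofFn fun i : Fin m => Y i.castSucc) 0 := by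
    rw [deletedWeight, List.ofFn_succ', List.concat_eq_append, List.drop_eq_nil_of_le (by simp)]
    simp
  have h0 := h (Y (Fin.last m))
  rw [Function.update_eq_self] at h0
  rw [h, h0, hd, wordVec_append_singleton_true]
  cases hY : Y (Fin.last m) <;> simp [letterSign, wordVec_append_singleton_true]

theorem eq_of_swapAt_eq {m : ℕ} {Y : Config (m + 1)} {i j : Fin m}
    (hi : Y i.castSucc ≠ Y i.succ) (h : swapAt i Y = swapAt j Y) : i = j := by
  have hmem : ∀ l, swapAt i Y l ≠ Y l → l = j.castSucc ∨ l = j.succ := by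
    intro l hl
    by_contra! hc
    exact hl (by rw [h, swapAt_of_ne Y hc.1 hc.2])
  have h1 := hmem i.castSucc (by rw [swapAt_castSucc]; exact hi.symm)
  have h2 := hmem i.succ (by rw [swapAt_succ]; exact hi)
  simp only [Fin.ext_iff, Fin.val_castSucc, Fin.val_succ] at h1 h2 ⊢
  omega

open Classical in
theorem sum_mul_ite_exists_swapAt {m : ℕ} (f : Config (m + 1) → ℝ) (Y : Config (m + 1))
    (b : Bool) :
    ∑ X, f X * (if ∃ i : Fin m, Y i.castSucc = b ∧ Y i.succ = !b ∧ X = swapAt i Y then 1 else 0) =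
      ∑ i : Fin m, if Y i.castSucc = b ∧ Y i.succ = !b then f (swapAt i Y) else 0 := by
  have h : ∀ X, f X *
      (if ∃ i : Fin m, Y i.castSucc = b ∧ Y i.succ = !b ∧ X = swapAt i Y then 1 else 0) =
      ∑ i : Fin m, if Y i.castSucc = b ∧ Y i.succ = !b ∧ X = swapAt i Y then f X else 0 := by
    intro X
    rw [Finset.sum_ite_zero]
    · simp
    · rintro i - j - ⟨h1, h2, h3⟩ ⟨-, -, h4⟩
      exact eq_of_swapAt_eq (by rw [h1, h2]; cases b <;> simp) (h3.symm.trans h4)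
  rw [Finset.sum_congr rfl fun X _ => h X, Finset.sum_comm]
  refine Finset.sum_congr rfl fun i _ => ?_
  by_cases hc : Y i.castSucc = b ∧ Y i.succ = !b
  · simp [hc]
  · rw [if_neg hc]
    refine Finset.sum_eq_zero fun X _ => if_neg fun hX => hc ⟨hX.1, hX.2.1⟩

theorem sum_mul_ite_and_eq {S : Type*} [Fintype S] (f : S → ℝ) (p : Prop) [Decidable p] (Y : S)
    [DecidablePred fun X => p ∧ X = Y] :
    ∑ X, f X * (if p ∧ X = Y then 1 else 0) = if p then f Y else 0 := by
  classical
  by_cases hp : p <;> simp [hp]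

/-- The flow into `Y`, up to the factor `m + 2`. -/
theorem sum_mul_jumpProb_in {m : ℕ} (q : ℝ) (f : Config (m + 1) → ℝ) (Y : Config (m + 1)) :
    (((m + 1 : ℕ) : ℝ) + 1) * ∑ X, f X * jumpProb 1 1 q X Y =
      ∑ i : Fin m, ((if Y i.castSucc = false ∧ Y i.succ = true then f (swapAt i Y) else 0) +
        q * (if Y i.castSucc = true ∧ Y i.succ = false then f (swapAt i Y) else 0)) +
      (if Y 0 = true then f (Function.update Y 0 false) else 0) +
      (if Y (Fin.last m) = false then f (Function.update Y (Fin.last m) true) else 0) := by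
  classical
  have h : ∀ X, (((m + 1 : ℕ) : ℝ) + 1) * (f X * jumpProb 1 1 q X Y) =
      f X * (if HopsRight X Y then 1 else 0) + q * (f X * (if HopsRight Y X then 1 else 0)) +
      f X * (if Enters X Y then 1 else 0) + f X * (if Exits X Y then 1 else 0) := by
    intro X
    rw [mul_left_comm, mul_jumpProb]
    ring
  have e1 := sum_mul_ite_exists_swapAt f Y false
  have e2 := sum_mul_ite_exists_swapAt f Y true
  simp only [Bool.not_false, Bool.not_true] at e1 e2
  rw [Finset.mul_sum, Finset.sum_congr rfl fun X _ => h X]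
  simp only [Finset.sum_add_distrib, ← Finset.mul_sum, hopsRight_iff' (Y := Y),
    hopsRight_iff (X := Y), enters_iff', exits_iff', e1, e2, sum_mul_ite_and_eq]

/-- The flow out of `Y`, up to the factor `m + 2`. -/
theorem sum_jumpProb_out {m : ℕ} (q : ℝ) (Y : Config (m + 1)) :
    (((m + 1 : ℕ) : ℝ) + 1) * ∑ X, jumpProb 1 1 q Y X =
      ∑ i : Fin m, ((if Y i.castSucc = true ∧ Y i.succ = false then 1 else 0) +
        q * (if Y i.castSucc = false ∧ Y i.succ = true then 1 else 0)) +
      (if Y 0 = false then 1 else 0) + (if Y (Fin.last m) = true then 1 else 0) := by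
  classical
  have h : ∀ X, (((m + 1 : ℕ) : ℝ) + 1) * jumpProb 1 1 q Y X =
      (if HopsRight Y X then 1 else 0) + q * (if HopsRight X Y then 1 else 0) +
      (if Enters Y X then 1 else 0) + (if Exits Y X then 1 else 0) := by
    intro X
    rw [mul_jumpProb]
  have e1 := sum_mul_ite_exists_swapAt (fun _ => 1) Y false
  have e2 := sum_mul_ite_exists_swapAt (fun _ => 1) Y true
  have e3 := sum_mul_ite_and_eq (fun _ => 1) (Y 0 = false) (Function.update Y 0 true)
  have e4 := sum_mul_ite_and_eq (fun _ => 1) (Y (Fin.last m) = true)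
    (Function.update Y (Fin.last m) false)
  simp only [Bool.not_false, Bool.not_true, one_mul] at e1 e2 e3 e4
  rw [Finset.mul_sum, Finset.sum_congr rfl fun X _ => h X]
  simp only [Finset.sum_add_distrib, ← Finset.mul_sum, hopsRight_iff' (Y := Y),
    hopsRight_iff (X := Y), enters_iff, exits_iff, e1, e2, e3, e4]

theorem isBalanced_configWeight (q : ℝ) (n : ℕ) :
    IsBalanced (jumpProb 1 1 q) (configWeight (n := n) 1 1 q) := by
  intro Y
  rcases n with _ | m
  · have h : ∀ X : Config 0, jumpProb 1 1 q X Y = 0 ∧ jumpProb 1 1 q Y X = 0 := by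
      intro X
      rw [Subsingleton.elim X Y]
      exact ⟨jumpProb_self q Y, jumpProb_self q Y⟩
    simp [h]
  · have hm : (((m + 1 : ℕ) : ℝ) + 1) ≠ 0 := by positivity
    refine mul_left_cancel₀ hm ?_
    rw [sum_mul_jumpProb_in, mul_left_comm, sum_jumpProb_out, ← sub_eq_zero]
    simp only [configWeight_eq_wordVec]
    have hb := Finset.sum_congr rfl fun (i : Fin m) (_ : i ∈ Finset.univ) =>
      bond_flow_eq_deletedWeight q Y i
    rw [Finset.sum_sub_distrib, Finset.sum_sub_distrib, ← Finset.mul_sum] at hb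
    have ht : ∑ i : Fin m, deletedWeight q Y i.castSucc + deletedWeight q Y (Fin.last m) =
        deletedWeight q Y 0 + ∑ i : Fin m, deletedWeight q Y i.succ := by
      rw [← Fin.sum_univ_castSucc, Fin.sum_univ_succ]
    linear_combination hb + left_flow q Y + right_flow q Y + ht

/-! ### Uniqueness of the stationary distribution -/

theorem jumpProb_pos_of_hopsRight {n : ℕ} (q : ℝ) {X Y : Config n} (h : HopsRight X Y) :
    0 < jumpProb 1 1 q X Y := by
  rw [jumpProb, if_pos h]
  positivity

theorem jumpProb_pos_of_enters {n : ℕ} {q : ℝ} (hq : 0 ≤ q) {X Y : Config n} (h : Enters X Y) :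
    0 < jumpProb 1 1 q X Y := by
  classical
  have hm := mul_jumpProb q X Y
  rw [if_pos h] at hm
  refine pos_of_mul_pos_right (a := (n : ℝ) + 1) ?_ (by positivity)
  rw [hm]
  split_ifs <;> linarith

theorem jumpProb_pos_of_exits {n : ℕ} {q : ℝ} (hq : 0 ≤ q) {X Y : Config n} (h : Exits X Y) :
    0 < jumpProb 1 1 q X Y := by
  classical
  have hm := mul_jumpProb q X Y
  rw [if_pos h] at hm
  refine pos_of_mul_pos_right (a := (n : ℝ) + 1) ?_ (by positivity)
  rw [hm]
  split_ifs <;> linarith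

/-- A configuration with a particle admits an exit or a hop to the right, and both bring the
particles closer to the right end. -/
theorem exists_jump_from {n : ℕ} {q : ℝ} (hq : 0 ≤ q) {X : Config n} (hX : X ≠ fun _ => false) :
    ∃ Y, 0 < jumpProb 1 1 q X Y ∧ siteSum (fun i => n - i) Y < siteSum (fun i => n - i) X := by
  rcases n with _ | m
  · exact absurd (Subsingleton.elim _ _) hX
  by_cases hl : X (Fin.last m) = true
  · have h : Exits X (Function.update X (Fin.last m) false) := exits_iff.2 ⟨hl, rfl⟩
    have := siteSum_exits (fun i => m + 1 - i) h
    exact ⟨_, jumpProb_pos_of_exits hq h, by omega⟩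
  · have hex : ∃ i : Fin m, X i.castSucc = true ∧ X i.succ = false := by
      by_contra! hc
      refine hX (funext fun i => ?_)
      induction i using Fin.reverseInduction with
      | last => simpa using hl
      | cast i ih =>
        by_contra hi
        exact hc i (by simpa using hi) ih
    obtain ⟨i, h1, h2⟩ := hex
    have h : HopsRight X (swapAt i X) := hopsRight_iff.2 ⟨i, h1, h2, rfl⟩
    obtain ⟨k, hk, hs⟩ := siteSum_hopsRight (fun i => m + 1 - i) h
    exact ⟨_, jumpProb_pos_of_hopsRight q h, by omega⟩

/-- A configuration with a particle arises by an entry or a hop to the right from one whose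
particles are closer to the left end. -/
theorem exists_jump_to {n : ℕ} {q : ℝ} (hq : 0 ≤ q) {X : Config n} (hX : X ≠ fun _ => false) :
    ∃ Y, 0 < jumpProb 1 1 q Y X ∧ siteSum (fun i => i + 1) Y < siteSum (fun i => i + 1) X := by
  rcases n with _ | m
  · exact absurd (Subsingleton.elim _ _) hX
  by_cases hl : X 0 = true
  · have h : Enters (Function.update X 0 false) X := enters_iff'.2 ⟨hl, rfl⟩
    have := siteSum_enters (fun i => i + 1) h
    exact ⟨_, jumpProb_pos_of_enters hq h, by omega⟩
  · have hex : ∃ i : Fin m, X i.castSucc = false ∧ X i.succ = true := by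
      by_contra! hc
      refine hX (funext fun i => ?_)
      induction i using Fin.induction with
      | zero => simpa using hl
      | succ i ih => simpa using hc i ih
    obtain ⟨i, h1, h2⟩ := hex
    have h : HopsRight (swapAt i X) X := hopsRight_iff'.2 ⟨i, h1, h2, rfl⟩
    obtain ⟨k, hk, hs⟩ := siteSum_hopsRight (fun i => i + 1) h
    exact ⟨_, jumpProb_pos_of_hopsRight q h, by omega⟩

/-- The zeros of a nonnegative balanced function are closed under predecessors. -/
theorem IsBalanced.eq_zero_of_pos {S : Type*} [Fintype S] {r : S → S → ℝ} {f : S → ℝ}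
    (h : IsBalanced r f) (hr : ∀ X Y, 0 ≤ r X Y) (hf : ∀ X, 0 ≤ f X) {X Y : S} (hY : f Y = 0)
    (hXY : 0 < r X Y) : f X = 0 := by
  have hs := h Y
  rw [hY, zero_mul, Finset.sum_eq_zero_iff_of_nonneg fun Z _ => mul_nonneg (hf Z) (hr Z Y)] at hs
  exact (mul_eq_zero.1 (hs X (Finset.mem_univ X))).resolve_right hXY.ne'

/-- The chain is irreducible: every configuration leads to the empty one, and the empty one leads
to every configuration. Hence a nonnegative balanced function with a zero vanishes. -/
theorem IsBalanced.eq_zero_of_exists {n : ℕ} {q : ℝ} (hq : 0 ≤ q) {f : Config n → ℝ}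
    (h : IsBalanced (jumpProb 1 1 q) f) (hf : ∀ X, 0 ≤ f X) {X₀ : Config n} (h0 : f X₀ = 0)
    (X : Config n) : f X = 0 := by
  have hzero := fun {X Y} => h.eq_zero_of_pos (X := X) (Y := Y) (jumpProb_nonneg hq) hf
  have hempty : ∀ N (Y : Config n), siteSum (fun i => i + 1) Y = N → f Y = 0 →
      f (fun _ => false) = 0 := by
    intro N
    induction N using Nat.strong_induction_on with
    | _ N ih =>
      intro Y hN hY
      by_cases hne : Y = fun _ => false
      · rwa [← hne]
      · obtain ⟨Z, hZ, hlt⟩ := exists_jump_to hq hne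
        exact ih _ (hN ▸ hlt) Z rfl (hzero hY hZ)
  have hall : ∀ N (Y : Config n), siteSum (fun i => n - i) Y = N → f Y = 0 := by
    intro N
    induction N using Nat.strong_induction_on with
    | _ N ih =>
      intro Y hN
      by_cases hne : Y = fun _ => false
      · rw [hne]
        exact hempty _ X₀ rfl h0
      · obtain ⟨Z, hZ, hlt⟩ := exists_jump_from hq hne
        exact hzero (ih _ (hN ▸ hlt) Z rfl) hZ
  exact hall _ X rfl

/-- The stationary distribution is proportional to the weights of the configurations. -/
theorem IsStationaryDist.eq_configWeight_div {n : ℕ} {q : ℝ} (hq : 0 ≤ q) {π : Config n → ℝ}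
    (h : IsStationaryDist (asep n 1 1 q) π) (X : Config n) :
    π X = configWeight 1 1 q X / partitionFn n 1 1 q := by
  obtain ⟨⟨h0, h1⟩, hP⟩ := h
  rw [vecMul_asep_eq_iff] at hP
  have hW := isBalanced_configWeight q n
  -- Subtract the largest multiple of the weights that keeps the difference nonnegative.
  obtain ⟨X₀, hX₀⟩ := Finite.exists_min fun Y => π Y / configWeight 1 1 q Y
  set c := π X₀ / configWeight 1 1 q X₀ with hc
  have hbal : IsBalanced (jumpProb 1 1 q) fun Y => π Y - c * configWeight 1 1 q Y := by
    intro Y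
    have e1 := hP Y
    have e2 := hW Y
    simp only [sub_mul, Finset.sum_sub_distrib, mul_assoc, ← Finset.mul_sum]
    rw [e1, e2]
  have hnn : ∀ Y, 0 ≤ π Y - c * configWeight 1 1 q Y := by
    intro Y
    rw [sub_nonneg, ← le_div_iff₀ (configWeight_pos hq Y)]
    exact hX₀ Y
  have hz : π X₀ - c * configWeight 1 1 q X₀ = 0 := by
    rw [hc, div_mul_cancel₀ _ (configWeight_pos hq X₀).ne', sub_self]
  have hπ : ∀ Y, π Y = c * configWeight 1 1 q Y := fun Y =>
    sub_eq_zero.1 (hbal.eq_zero_of_exists hq hnn hz Y)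
  have hcZ : c * partitionFn n 1 1 q = 1 := by
    rw [partitionFn, Finset.mul_sum, ← Finset.sum_congr rfl fun Y _ => hπ Y, h1]
  rw [eq_div_iff (partitionFn_pos hq n).ne', hπ]
  linear_combination configWeight 1 1 q X * hcZ

theorem isStationaryDist_configWeight_div {n : ℕ} {q : ℝ} (hq : 0 ≤ q) :
    IsStationaryDist (asep n 1 1 q) fun X => configWeight 1 1 q X / partitionFn n 1 1 q := by
  have hZ := partitionFn_pos hq n
  refine ⟨⟨fun X => (div_pos (configWeight_pos hq X) hZ).le, ?_⟩, ?_⟩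
  · rw [← Finset.sum_div]
    exact div_self hZ.ne'
  · rw [vecMul_asep_eq_iff]
    intro Y
    simp only [div_mul_eq_mul_div, ← Finset.sum_div]
    rw [isBalanced_configWeight q n Y]

end

theorem mainTheorem5 (n : ℕ) (q : ℝ) (hq : 0 ≤ q) :
    (∃! π : Config n → ℝ, IsStationaryDist (asep n 1 1 q) π) ∧
    0 < partitionFn n 1 1 q ∧
    ∀ k : ℕ, k ≤ n →
      Polynomial.toLaurent (qEulerian (k + 1) (n + 1)) = qEulerianLaurent (k + 1) (n + 1) ∧
      ∀ π : Config n → ℝ, IsStationaryDist (asep n 1 1 q) π →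
        ∑ X ∈ Finset.univ.filter (fun X : Config n => numParticles X = k), π X =
          Polynomial.aeval q (qEulerian (k + 1) (n + 1)) / partitionFn n 1 1 q := by
  have hZ := partitionFn_pos hq n
  refine ⟨⟨_, isStationaryDist_configWeight_div hq, fun π hπ => funext (hπ.eq_configWeight_div hq)⟩,
    hZ, fun k _ => ⟨toLaurent_qEulerian n k, fun π hπ => ?_⟩⟩
  rw [Finset.sum_congr rfl fun X _ => hπ.eq_configWeight_div hq X, ← Finset.sum_div,
    aeval_qEulerian]
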